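/- Let $P\subset\mathbb{R}^3$ be a lattice $3$-polytope of size $5$ and signature $(3,1)$. That is, $P$ is the convex hull of a finite subset of $\mathbb{Z}^3$, it contains four affinely independent points, it contains exactly five points of $\mathbb{Z}^3$, and the affine dependence among these five points (unique up to a nonzero factor) has three coefficients of one sign, one of the opposite sign, and one equal to zero. Then there is $q\in\{1,3\}$ such that $P$ has volume vector $(-3q,q,q,q,0)$, i.e. the five lattice points can be ordered as $p_1,\dots,p_5$ so that $$(w_{2345},\,-w_{1345},\,w_{1245},\,-w_{1235},\,w_{1234})=(-3q,q,q,q,0),\qquad w_{ijkl}:=\det\begin{pmatrix}1&1&1&1\\ p_i&p_j&p_k&p_l\end{pmatrix}.$$ Moreover, $P$ is $\mathbb{Z}$-equivalent (by an affine bijection $t$ of $\mathbb{R}^3$ with $t(\mathbb{Z}^3)=\mathbb{Z}^3$) to one of 1. $\operatorname{conv}\{(0,0,0),(1,0,0),(0,0,1),(-1,0,-1),(0,1,0)\}$, 2. $\operatorname{conv}\{(0,0,0),(1,0,0),(0,0,1),(-1,0,-1),(2,3,1)\}$. The first of these two polytopes has width one and the second has width two, where the width of a polytope $Q$ is the minimum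 of $\max_Q f-\min_Q f$ over all non-constant affine functionals $f:\mathbb{R}^3\to\mathbb{R}$ with $f(\mathbb{Z}^3)\subset\mathbb{Z}$. -/

import Mathlib

noncomputable section

namespace LatticePolytope

/-- The integer lattice `ℤ^d`, as a subset of `ℝ^d`. -/
def lattice (d : ℕ) : Set (Fin d → ℝ) :=
  {x | ∀ i, ∃ n : ℤ, x i = (n : ℝ)}

/-- A lattice polytope: the convex hull of a finite set of lattice points. -/
def IsLatticePolytope {d : ℕ} (P : Set (Fin d → ℝ)) : Prop :=
  ∃ S : Set (Fin d → ℝ), S.Finite ∧ S ⊆ lattice d ∧ P = convexHull ℝ S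

/-- `P ⊆ ℝ^d` is `d`-dimensional: it contains `d + 1` affinely independent points. -/
def IsFullDimensional {d : ℕ} (P : Set (Fin d → ℝ)) : Prop :=
  ∃ p : Fin (d + 1) → (Fin d → ℝ), AffineIndependent ℝ p ∧ ∀ i, p i ∈ P

/-- A lattice `d`-polytope in `ℝ^d`. -/
def IsLatticeDPolytope {d : ℕ} (P : Set (Fin d → ℝ)) : Prop :=
  IsLatticePolytope P ∧ IsFullDimensional P

/-- The size of `P`: its number of lattice points. -/
def size {d : ℕ} (P : Set (Fin d → ℝ)) : ℕ :=
  (P ∩ lattice d).ncard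

/-- `p` lists the lattice points of `P`, each exactly once. -/
def IsOrdering {d n : ℕ} (P : Set (Fin d → ℝ)) (p : Fin n → (Fin d → ℝ)) : Prop :=
  Function.Injective p ∧ Set.range p = P ∩ lattice d

/-- `c` is a (nontrivial) affine dependence on the points `p`. -/
def IsAffineDependence {d n : ℕ} (p : Fin n → (Fin d → ℝ)) (c : Fin n → ℝ) : Prop :=
  c ≠ 0 ∧ ∑ k, c k = 0 ∧ ∑ k, c k • p k = 0

/-- `P`, of size `d + 2`, has signature `(i, j)`: the affine dependence on its lattice points
(unique up to a nonzero factor when `P` is a lattice `d`-polytope) has `i` positive and `j`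
negative coefficients. As `c` may be replaced by `-c`, `(i, j)` and `(j, i)` are the same. -/
def HasSignature {d : ℕ} (P : Set (Fin d → ℝ)) (i j : ℕ) : Prop :=
  ∃ p : Fin (d + 2) → (Fin d → ℝ), IsOrdering P p ∧
    ∃ c : Fin (d + 2) → ℝ, IsAffineDependence p c ∧
      {k | 0 < c k}.ncard = i ∧ {k | c k < 0}.ncard = j

/-- The signed normalized volume of `d + 1` points: the determinant of the matrix whose
`k`-th column is `(1, p k)`. -/
def signedVolume {d : ℕ} (p : Fin (d + 1) → (Fin d → ℝ)) : ℝ :=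
  Matrix.det (Matrix.of fun r k : Fin (d + 1) => (Fin.cons 1 (p k) : Fin (d + 1) → ℝ) r)

/-- The volume vector of `d + 2` ordered points: the `k`-th entry is `(-1)^k` (with `k` counted
from `0`) times the signed volume of the points other than the `k`-th one. For five points in
`ℝ^3` it is `(w₂₃₄₅, -w₁₃₄₅, w₁₂₄₅, -w₁₂₃₅, w₁₂₃₄)`. -/
def volumeVector {d : ℕ} (p : Fin (d + 2) → (Fin d → ℝ)) : Fin (d + 2) → ℝ :=
  fun k => (-1) ^ (k : ℕ) * signedVolume (fun i => p (k.succAbove i))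

/-- `P`, of size `d + 2`, has volume vector `v`, for a suitable ordering of its lattice points. -/
def HasVolumeVector {d : ℕ} (P : Set (Fin d → ℝ)) (v : Fin (d + 2) → ℝ) : Prop :=
  ∃ p : Fin (d + 2) → (Fin d → ℝ), IsOrdering P p ∧ volumeVector p = v

/-- `P` and `Q` are `ℤ`-equivalent (unimodularly equivalent). -/
def ZEquivalent {d : ℕ} (P Q : Set (Fin d → ℝ)) : Prop :=
  ∃ t : (Fin d → ℝ) ≃ᵃ[ℝ] (Fin d → ℝ), t '' lattice d = lattice d ∧ t '' P = Q

/-- A non-constant affine functional that takes integer values on the lattice. -/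
def IsIntegerFunctional {d : ℕ} (f : (Fin d → ℝ) →ᵃ[ℝ] ℝ) : Prop :=
  (∀ x ∈ lattice d, ∃ n : ℤ, f x = (n : ℝ)) ∧ ∃ x y, f x ≠ f y

/-- The width of `P` with respect to `f` is `w = max_P f - min_P f`. -/
def HasWidthWrt {d : ℕ} (P : Set (Fin d → ℝ)) (f : (Fin d → ℝ) →ᵃ[ℝ] ℝ) (w : ℝ) : Prop :=
  ∃ a b : ℝ, IsLeast (f '' P) a ∧ IsGreatest (f '' P) b ∧ w = b - a

/-- The (lattice) width of `P` is `w`: the minimum of the widths of `P` with respect to the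
non-constant integer affine functionals. -/
def HasWidth {d : ℕ} (P : Set (Fin d → ℝ)) (w : ℝ) : Prop :=
  IsLeast {u | ∃ f : (Fin d → ℝ) →ᵃ[ℝ] ℝ, IsIntegerFunctional f ∧ HasWidthWrt P f u} w

/-- The first configuration of signature `(3,1)`. -/
def config₁ : Set (Fin 3 → ℝ) :=
  convexHull ℝ {![0, 0, 0], ![1, 0, 0], ![0, 0, 1], ![-1, 0, -1], ![0, 1, 0]}

/-- The second configuration of signature `(3,1)`. -/
def config₂ : Set (Fin 3 → ℝ) :=
  convexHull ℝ {![0, 0, 0], ![1, 0, 0], ![0, 0, 1], ![-1, 0, -1], ![2, 3, 1]}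

end LatticePolytope

end

namespace LatticePolytope

open Set

/-! Write `p 0` for the interior point of the triangle and `p 4` for the apex. As `P` has no further
lattice points, `p 0` and any two vertices of the triangle span a unimodular triangle
(`int_of_mem_lattice`). Over the three subtriangles this makes the ratios of the dependence
coefficients, and their inverses, integers, so `p 0` is the centroid (`interior_eq_centroid`).

Complete `u = p 1 - p 0` and `v = p 2 - p 0` by some `r` to a lattice basis (`exists_generates`).
The apex is `a u + b v + q r` relative to `p 0`, and changing the sign of `r` and shearing it gives
`q > 0` and `0 ≤ a, b < q`. For `q ≥ 2` the slice of `P` at `r`-height one contains no lattice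
point, which forces `(a, b, q)` to be a multiple of `(2, 1, 3)` or `(1, 2, 3)` (`apex_arith`). The
multiple is 1, since otherwise the segment from `p 0` to the apex contains another lattice point.
Swapping `u` and `v` identifies the two cases, so `q = 1` and `q = 3` give the two normal forms
(`exists_normal_form`), from which volume vector and equivalence are read off.

The widths follow by evaluating integer functionals at the listed points. -/

/-! ### The triple product -/

/-- The determinant of three vectors of `ℝ^3`. -/
def det3 (x y z : Fin 3 → ℝ) : ℝ :=
  x 0 * (y 1 * z 2 - y 2 * z 1) - x 1 * (y 0 * z 2 - y 2 * z 0) + x 2 * (y 0 * z 1 - y 1 * z 0)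

lemma det3_combination (u v w : Fin 3 → ℝ) (a b c a' b' c' a'' b'' c'' : ℝ) :
    det3 (a • u + b • v + c • w) (a' • u + b' • v + c' • w) (a'' • u + b'' • v + c'' • w) =
      det3 ![a, b, c] ![a', b', c'] ![a'', b'', c''] * det3 u v w := by
  simp [det3]
  ring

lemma det3_right_combination (u v w : Fin 3 → ℝ) (a b c : ℝ) :
    det3 u v (a • u + b • v + c • w) = c * det3 u v w := by
  simp [det3]
  ring

/-- Pairing the relation with the cross products `v × w`, `w × u`, `u × v` isolates one coefficient
each time. -/
lemma det3_eq_zero_of_combination {u v w : Fin 3 → ℝ} {a b c : ℝ}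
    (h : a • u + b • v + c • w = 0) :
    a * det3 u v w = 0 ∧ b * det3 u v w = 0 ∧ c * det3 u v w = 0 := by
  have h0 := congrFun h 0
  have h1 := congrFun h 1
  have h2 := congrFun h 2
  simp only [Pi.add_apply, Pi.smul_apply, smul_eq_mul, Pi.zero_apply] at h0 h1 h2
  simp only [det3]
  refine ⟨?_, ?_, ?_⟩
  · linear_combination (v 1 * w 2 - v 2 * w 1) * h0 - (v 0 * w 2 - v 2 * w 0) * h1 +
      (v 0 * w 1 - v 1 * w 0) * h2
  · linear_combination (w 1 * u 2 - w 2 * u 1) * h0 - (w 0 * u 2 - w 2 * u 0) * h1 +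
      (w 0 * u 1 - w 1 * u 0) * h2
  · linear_combination (u 1 * v 2 - u 2 * v 1) * h0 - (u 0 * v 2 - u 2 * v 0) * h1 +
      (u 0 * v 1 - u 1 * v 0) * h2

lemma combination_unique {u v w : Fin 3 → ℝ} (h : det3 u v w ≠ 0) {a b c a' b' c' : ℝ}
    (e : a • u + b • v + c • w = a' • u + b' • v + c' • w) : a = a' ∧ b = b' ∧ c = c' := by
  have e' : (a - a') • u + (b - b') • v + (c - c') • w = 0 := by
    rw [← sub_eq_zero] at e
    rw [← e]
    module
  obtain ⟨h1, h2, h3⟩ := det3_eq_zero_of_combination e'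
  simp only [mul_eq_zero, h, or_false, sub_eq_zero] at h1 h2 h3
  exact ⟨h1, h2, h3⟩

lemma exists_combination {u v w : Fin 3 → ℝ} (h : det3 u v w ≠ 0) (x : Fin 3 → ℝ) :
    x = (det3 x v w / det3 u v w) • u + (det3 u x w / det3 u v w) • v +
      (det3 u v x / det3 u v w) • w := by
  have key : det3 u v w • x = det3 x v w • u + det3 u x w • v + det3 u v x • w := by
    ext i
    fin_cases i <;> simp [det3] <;> ring
  calc x = (det3 u v w)⁻¹ • (det3 u v w • x) := by rw [smul_smul, inv_mul_cancel₀ h, one_smul]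
    _ = _ := by rw [key]; simp only [div_eq_inv_mul]; module

lemma eq_combination_of_pos {x y z : Fin 3 → ℝ} {a b c : ℝ} (hc : 0 < c)
    (h : a • x + b • y + c • z = 0) : z = (-(a / c)) • x + (-(b / c)) • y := by
  have e : z = c⁻¹ • (c • z) := by rw [smul_smul, inv_mul_cancel₀ hc.ne', one_smul]
  rw [e, eq_neg_of_add_eq_zero_right h]
  simp only [div_eq_inv_mul]
  module

/-! ### The lattice -/

lemma lattice_add {d : ℕ} {x y : Fin d → ℝ} (hx : x ∈ lattice d) (hy : y ∈ lattice d) :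
    x + y ∈ lattice d := fun i => by
  obtain ⟨m, hm⟩ := hx i
  obtain ⟨n, hn⟩ := hy i
  exact ⟨m + n, by simp [hm, hn]⟩

lemma lattice_smul {d : ℕ} {x : Fin d → ℝ} (hx : x ∈ lattice d) (k : ℤ) :
    (k : ℝ) • x ∈ lattice d := fun i => by
  obtain ⟨m, hm⟩ := hx i
  exact ⟨k * m, by simp [hm]⟩

lemma lattice_sub {d : ℕ} {x y : Fin d → ℝ} (hx : x ∈ lattice d) (hy : y ∈ lattice d) :
    x - y ∈ lattice d := fun i => by
  obtain ⟨m, hm⟩ := hx i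
  obtain ⟨n, hn⟩ := hy i
  exact ⟨m - n, by simp [hm, hn]⟩

lemma det3_int {x y z : Fin 3 → ℝ} (hx : x ∈ lattice 3) (hy : y ∈ lattice 3)
    (hz : z ∈ lattice 3) : ∃ n : ℤ, det3 x y z = n := by
  choose x' hx' using hx
  choose y' hy' using hy
  choose z' hz' using hz
  refine ⟨x' 0 * (y' 1 * z' 2 - y' 2 * z' 1) - x' 1 * (y' 0 * z' 2 - y' 2 * z' 0) +
    x' 2 * (y' 0 * z' 1 - y' 1 * z' 0), ?_⟩
  simp only [det3, hx', hy', hz']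
  push_cast
  ring

lemma vec3_mem_lattice (a b c : ℤ) : (![(a : ℝ), b, c] : Fin 3 → ℝ) ∈ lattice 3 := fun i => by
  fin_cases i
  exacts [⟨a, rfl⟩, ⟨b, rfl⟩, ⟨c, rfl⟩]

/-- The vectors `u`, `v`, `w` generate the lattice `ℤ^3`. -/
def Generates (u v w : Fin 3 → ℝ) : Prop :=
  ∀ x ∈ lattice 3, ∃ a b c : ℤ, x = (a : ℝ) • u + (b : ℝ) • v + (c : ℝ) • w

/-- The standard basis has integer coordinates in `u`, `v`, `w`, so the integer `det3 u v w` divides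
1. -/
lemma Generates.det3_eq {u v w : Fin 3 → ℝ} (h : Generates u v w) (hu : u ∈ lattice 3)
    (hv : v ∈ lattice 3) (hw : w ∈ lattice 3) : det3 u v w = 1 ∨ det3 u v w = -1 := by
  obtain ⟨a, b, c, e⟩ := h ![1, 0, 0] (by simpa using vec3_mem_lattice 1 0 0)
  obtain ⟨a', b', c', e'⟩ := h ![0, 1, 0] (by simpa using vec3_mem_lattice 0 1 0)
  obtain ⟨a'', b'', c'', e''⟩ := h ![0, 0, 1] (by simpa using vec3_mem_lattice 0 0 1)
  have key := det3_combination u v w a b c a' b' c' a'' b'' c''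
  rw [← e, ← e', ← e''] at key
  obtain ⟨m, hm⟩ := det3_int (vec3_mem_lattice a b c) (vec3_mem_lattice a' b' c')
    (vec3_mem_lattice a'' b'' c'')
  obtain ⟨n, hn⟩ := det3_int hu hv hw
  rw [hm, hn] at key
  have h1 : det3 ![1, 0, 0] ![0, 1, 0] ![0, 0, 1] = 1 := by simp [det3]
  rw [h1] at key
  have key' : m * n = 1 := by exact_mod_cast key.symm
  rw [hn]
  rcases Int.isUnit_iff.1 (IsUnit.of_mul_eq_one m (by rw [mul_comm]; exact key')) with h | h <;>
    simp [h]

/-- Two lattice vectors that generate the lattice points of their plane extend to generators of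
the lattice. -/
lemma exists_generates {u v w : Fin 3 → ℝ} (hu : u ∈ lattice 3) (hv : v ∈ lattice 3)
    (hw : w ∈ lattice 3) (hd : det3 u v w ≠ 0)
    (hprim : ∀ α β : ℝ, α • u + β • v ∈ lattice 3 → ∃ m n : ℤ, α = m ∧ β = n) :
    ∃ r ∈ lattice 3, Generates u v r := by
  -- Take `r` with the least positive value of `det3 u v r`. Division with remainder makes every
  -- other value a multiple of it, and what is left lies in the plane of `u`, `v`, where `hprim`
  -- applies.
  have hex : ∃ n : ℕ, 0 < n ∧ ∃ x ∈ lattice 3, det3 u v x = n := by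
    obtain ⟨n, hn⟩ := det3_int hu hv hw
    have hn0 : n ≠ 0 := by rintro rfl; simp [hn] at hd
    refine ⟨n.natAbs, Int.natAbs_pos.2 hn0, (n.sign : ℝ) • w, lattice_smul hw _, ?_⟩
    have e := det3_right_combination u v w 0 0 n.sign
    simp only [zero_smul, zero_add] at e
    rw [e, hn, ← Int.cast_mul, Int.sign_mul_self_eq_natAbs]
    simp
  classical
  obtain ⟨hg, r, hr, hdr⟩ := Nat.find_spec hex
  set g := Nat.find hex with hgdef
  refine ⟨r, hr, fun x hx => ?_⟩
  obtain ⟨n, hn⟩ := det3_int hu hv hx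
  have hg' : (0 : ℤ) < g := by exact_mod_cast hg
  set k := n / (g : ℤ)
  have hy : x - (k : ℝ) • r ∈ lattice 3 := lattice_sub hx (lattice_smul hr k)
  have hdy : det3 u v (x - (k : ℝ) • r) = ((n % (g : ℤ) : ℤ) : ℝ) := by
    have e : det3 u v (x - (k : ℝ) • r) = det3 u v x - k * det3 u v r := by
      simp [det3]; ring
    rw [e, hn, hdr]
    have := Int.emod_add_mul_ediv n g
    have h' : n % (g : ℤ) = n - k * g := by linarith [this, mul_comm k (g : ℤ)]
    rw [h']; push_cast; ring
  have hmod : n % (g : ℤ) = 0 := by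
    by_contra hne
    have h0 := Int.emod_nonneg n hg'.ne'
    have h1 := Int.emod_lt_of_pos n hg'
    refine Nat.find_min hex (m := (n % (g : ℤ)).toNat) (by omega) ⟨by omega, _, hy, ?_⟩
    rw [hdy]
    have : ((n % (g : ℤ)).toNat : ℤ) = n % (g : ℤ) := Int.toNat_of_nonneg h0
    exact_mod_cast this.symm
  have e := exists_combination hd (x - (k : ℝ) • r)
  rw [hdy, hmod, Int.cast_zero, zero_div, zero_smul, add_zero] at e
  obtain ⟨m, m', h1, h2⟩ := hprim _ _ (e ▸ hy)
  rw [h1, h2] at e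
  exact ⟨m, m', k, by rw [← e]; simp⟩

/-! ### Orderings -/

lemma IsOrdering.eq_convexHull {d n : ℕ} {P : Set (Fin d → ℝ)} {p : Fin n → (Fin d → ℝ)}
    (h : IsOrdering P p) (hP : IsLatticePolytope P) : P = convexHull ℝ (range p) := by
  obtain ⟨S, -, hS, rfl⟩ := hP
  apply Subset.antisymm
  · apply convexHull_mono
    rw [h.2]
    exact fun x hx => ⟨subset_convexHull ℝ S hx, hS hx⟩
  · apply convexHull_min _ (convex_convexHull ℝ S)
    rw [h.2]
    exact inter_subset_left

lemma IsOrdering.comp {d n : ℕ} {P : Set (Fin d → ℝ)} {p : Fin n → (Fin d → ℝ)}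
    (h : IsOrdering P p) {σ : Fin n → Fin n} (hσ : Function.Injective σ) :
    IsOrdering P (p ∘ σ) :=
  ⟨h.1.comp hσ, by rw [(Finite.surjective_of_injective hσ).range_comp, h.2]⟩

lemma IsOrdering.mem_lattice {d n : ℕ} {P : Set (Fin d → ℝ)} {p : Fin n → (Fin d → ℝ)}
    (h : IsOrdering P p) (i : Fin n) : p i ∈ lattice d :=
  (h.2 ▸ mem_range_self i : p i ∈ P ∩ lattice d).2

/-- Otherwise some nonzero `φ` is orthogonal to all `p i - p 0`, and `P` lies in a plane. -/
lemma det3_ne_zero {P : Set (Fin 3 → ℝ)} {p : Fin 5 → (Fin 3 → ℝ)}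
    (hP : P = convexHull ℝ (range p)) (hd : IsFullDimensional P) {a b c : ℝ} (hc : c ≠ 0)
    (h : a • (p 1 - p 0) + b • (p 2 - p 0) + c • (p 3 - p 0) = 0) :
    det3 (p 1 - p 0) (p 2 - p 0) (p 4 - p 0) ≠ 0 := by
  intro h0
  obtain ⟨φ, hφ, hz⟩ := Matrix.exists_mulVec_eq_zero_iff.2
    (show (Matrix.of ![p 1 - p 0, p 2 - p 0, p 4 - p 0]).det = 0 by
      rw [Matrix.det_fin_three, ← h0]; simp [det3]; ring)
  have h1 : (p 1 - p 0) ⬝ᵥ φ = 0 := congrFun hz 0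
  have h2 : (p 2 - p 0) ⬝ᵥ φ = 0 := congrFun hz 1
  have h4 : (p 4 - p 0) ⬝ᵥ φ = 0 := congrFun hz 2
  have h3 : (p 3 - p 0) ⬝ᵥ φ = 0 := by
    have := congrArg (· ⬝ᵥ φ) h
    simp only [add_dotProduct, smul_dotProduct, h1, h2, zero_dotProduct, smul_eq_mul, mul_zero,
      zero_add, mul_eq_zero, hc, false_or] at this
    exact this
  have hsub : P ⊆ {x | x ⬝ᵥ φ = p 0 ⬝ᵥ φ} := by
    rw [hP]
    apply convexHull_min
    · rintro _ ⟨i, rfl⟩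
      simp only [sub_dotProduct, sub_eq_zero] at h1 h2 h3 h4
      fin_cases i
      exacts [rfl, h1, h2, h3, h4]
    · intro x hx y hy s t _ _ hst
      simp only [mem_ofPred_eq] at hx hy ⊢
      rw [add_dotProduct, smul_dotProduct, smul_dotProduct, hx, hy, ← add_smul, hst, one_smul]
  obtain ⟨q, hq, hqP⟩ := hd
  have hli := (affineIndependent_iff_linearIndependent_vsub ℝ q 0).1 hq
  have hli' : LinearIndependent ℝ (fun i : Fin 3 => q i.succ - q 0) :=
    hli.comp (fun i : Fin 3 => (⟨i.succ, Fin.succ_ne_zero i⟩ : {x : Fin 4 // x ≠ 0}))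
      (fun i j hij => Fin.succ_injective _ (congrArg Subtype.val hij))
  have hu := (Matrix.linearIndependent_rows_iff_isUnit
    (A := Matrix.of fun i : Fin 3 => q i.succ - q 0)).1 hli'
  refine hφ (Matrix.mulVec_injective_iff_isUnit.2 hu ?_)
  rw [Matrix.mulVec_zero]
  ext i
  change (q i.succ - q 0) ⬝ᵥ φ = 0
  rw [sub_dotProduct, hsub (hqP _), hsub (hqP 0), sub_self]

/-- In signature `(3,1)` the lattice points can be ordered with the interior point of the triangle
first and the apex last. -/
lemma exists_ordering_of_signature {P : Set (Fin 3 → ℝ)} (h : HasSignature P 3 1) :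
    ∃ p : Fin 5 → (Fin 3 → ℝ), IsOrdering P p ∧ ∃ a b c : ℝ, 0 < a ∧ 0 < b ∧ 0 < c ∧
      a • (p 1 - p 0) + b • (p 2 - p 0) + c • (p 3 - p 0) = 0 := by
  obtain ⟨p, hp, c, ⟨-, hc0, hcp⟩, hpos, hneg⟩ := h
  obtain ⟨i, hi⟩ := ncard_eq_one.1 hneg
  obtain ⟨j, k, l, hjk, hjl, hkl, hpos'⟩ := ncard_eq_three.1 hpos
  have hin : c i < 0 := (hi ▸ mem_singleton i : i ∈ {k | c k < 0})
  have hj : 0 < c j := (hpos' ▸ by simp : j ∈ {k | 0 < c k})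
  have hk : 0 < c k := (hpos' ▸ by simp : k ∈ {k | 0 < c k})
  have hl : 0 < c l := (hpos' ▸ by simp : l ∈ {k | 0 < c k})
  -- The remaining index carries the zero coefficient: it will label the apex.
  obtain ⟨m, hm⟩ : ∃ m : Fin 5, m ∉ ({i, j, k, l} : Finset (Fin 5)) := by
    by_contra! hall
    have := Finset.card_le_card (fun x _ => hall x : Finset.univ ⊆ ({i, j, k, l} : Finset (Fin 5)))
    have h4 := Finset.card_le_four (a := i) (b := j) (c := k) (d := l)
    simp only [Finset.card_univ, Fintype.card_fin] at this
    omega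
  simp only [Finset.mem_insert, Finset.mem_singleton, not_or] at hm
  have hcm : c m = 0 := by
    apply le_antisymm
    · by_contra! hlt
      have : m ∈ ({j, k, l} : Set (Fin 5)) := hpos' ▸ hlt
      simp only [mem_insert_iff, mem_singleton_iff] at this
      tauto
    · by_contra! hlt
      have : m ∈ ({i} : Set (Fin 5)) := hi ▸ hlt
      exact hm.1 this
  have hij : i ≠ j := by rintro rfl; linarith
  have hik : i ≠ k := by rintro rfl; linarith
  have hil : i ≠ l := by rintro rfl; linarith
  have hinj : Function.Injective ![i, j, k, l, m] := by
    obtain ⟨hm1, hm2, hm3, hm4⟩ := hm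
    intro x y hxy
    fin_cases x <;> fin_cases y <;> simp at hxy ⊢ <;> simp_all
  refine ⟨_, hp.comp hinj, c j, c k, c l, hj, hk, hl, ?_⟩
  have hbij := (Finite.injective_iff_bijective).1 hinj
  rw [← hbij.sum_comp] at hc0 hcp
  simp only [Fin.sum_univ_succ, Fin.sum_univ_zero] at hc0 hcp
  simp [hcm] at hc0 hcp ⊢
  have e : c j • (p j - p i) + c k • (p k - p i) + c l • (p l - p i) =
      (c i • p i + (c j • p j + (c k • p k + c l • p l))) - (c i + (c j + (c k + c l))) • p i := by
    module
  rw [e, hcp, hc0, zero_smul, sub_zero]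

/-! ### The triangle -/

lemma combination_mem {P : Set (Fin 3 → ℝ)} {p : Fin 5 → (Fin 3 → ℝ)}
    (hP : P = convexHull ℝ (range p)) {a b c d : ℝ} (ha : 0 ≤ a) (hb : 0 ≤ b) (hc : 0 ≤ c)
    (hd : 0 ≤ d) (h : a + b + c + d ≤ 1) :
    p 0 + a • (p 1 - p 0) + b • (p 2 - p 0) + c • (p 3 - p 0) + d • (p 4 - p 0) ∈ P := by
  have hmem := (convex_convexHull ℝ (range p)).sum_mem (t := Finset.univ)
    (w := ![1 - a - b - c - d, a, b, c, d]) (z := p)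
    (by intro i _; fin_cases i <;> simp <;> linarith)
    (by simp [Fin.sum_univ_succ]; ring)
    (fun i _ => subset_convexHull ℝ _ (mem_range_self i))
  rw [hP]
  convert hmem using 1
  simp [Fin.sum_univ_succ]
  module

/-- The triangle spanned by the interior point and two of the vertices is unimodular. -/
lemma int_of_mem_lattice {P : Set (Fin 3 → ℝ)} {p : Fin 5 → (Fin 3 → ℝ)} (h : IsOrdering P p)
    (hP : P = convexHull ℝ (range p)) {a b c : ℝ} (ha : 0 < a) (hb : 0 < b) (hc : 0 < c)
    (he : a • (p 1 - p 0) + b • (p 2 - p 0) + c • (p 3 - p 0) = 0)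
    (hd : det3 (p 1 - p 0) (p 2 - p 0) (p 4 - p 0) ≠ 0) (α β : ℝ)
    (hl : α • (p 1 - p 0) + β • (p 2 - p 0) ∈ lattice 3) : ∃ m n : ℤ, α = m ∧ β = n := by
  have hs := eq_combination_of_pos hc he
  have hac := div_pos ha hc
  have hbc := div_pos hb hc
  have hu : p 1 - p 0 ∈ lattice 3 := lattice_sub (h.mem_lattice 1) (h.mem_lattice 0)
  have hv : p 2 - p 0 ∈ lattice 3 := lattice_sub (h.mem_lattice 2) (h.mem_lattice 0)
  -- Such a point lies in `P`, so it is one of the five; `p 3` is excluded because its coordinates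
  -- are negative.
  have key : ∀ s t : ℝ, 0 ≤ s → 0 ≤ t → s + t ≤ 1 → s < 1 → t < 1 →
      s • (p 1 - p 0) + t • (p 2 - p 0) ∈ lattice 3 → s = 0 ∧ t = 0 := by
    intro s t hs0 ht0 hst hs1 ht1 hmem
    have hx : p 0 + s • (p 1 - p 0) + t • (p 2 - p 0) ∈ P := by
      simpa using combination_mem hP hs0 ht0 le_rfl le_rfl (by linarith)
    have hx' : p 0 + s • (p 1 - p 0) + t • (p 2 - p 0) ∈ lattice 3 := by
      rw [add_assoc]; exact lattice_add (h.mem_lattice 0) hmem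
    obtain ⟨i, hi⟩ : p 0 + s • (p 1 - p 0) + t • (p 2 - p 0) ∈ range p := h.2 ▸ ⟨hx, hx'⟩
    have hi' : s • (p 1 - p 0) + t • (p 2 - p 0) + (0 : ℝ) • (p 4 - p 0) = p i - p 0 := by
      rw [hi]; module
    have hcase : ∀ s' t' r' : ℝ,
        p i - p 0 = s' • (p 1 - p 0) + t' • (p 2 - p 0) + r' • (p 4 - p 0) →
        s = s' ∧ t = t' ∧ 0 = r' :=
      fun s' t' r' e => combination_unique hd (hi'.trans e)
    fin_cases i
    · obtain ⟨h1, h2, -⟩ := hcase 0 0 0 (by simp)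
      exact ⟨h1, h2⟩
    · obtain ⟨h1, -, -⟩ := hcase 1 0 0 (by simp)
      linarith
    · obtain ⟨-, h1, -⟩ := hcase 0 1 0 (by simp)
      linarith
    · obtain ⟨h1, -, -⟩ := hcase (-(a / c)) (-(b / c)) 0
        (by rw [zero_smul, add_zero]; exact hs)
      linarith
    · obtain ⟨-, -, h1⟩ := hcase 0 0 1 (by simp)
      linarith
  have hf : Int.fract α • (p 1 - p 0) + Int.fract β • (p 2 - p 0) ∈ lattice 3 := by
    have := lattice_sub (lattice_sub hl (lattice_smul hu ⌊α⌋)) (lattice_smul hv ⌊β⌋)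
    convert this using 1
    simp only [Int.fract]
    module
  suffices Int.fract α = 0 ∧ Int.fract β = 0 by
    refine ⟨⌊α⌋, ⌊β⌋, ?_, ?_⟩
    · have := Int.floor_add_fract α; rw [← this]; simp [*]
    · have := Int.floor_add_fract β; rw [← this]; simp [*]
  have hα0 := Int.fract_nonneg α
  have hβ0 := Int.fract_nonneg β
  have hα1 := Int.fract_lt_one α
  have hβ1 := Int.fract_lt_one β
  rcases le_or_gt (Int.fract α + Int.fract β) 1 with hle | hgt
  · exact key _ _ hα0 hβ0 hle hα1 hβ1 hf
  -- The far half of the parallelogram is reflected into the near half by `x ↦ u + v - x`.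
  · exfalso
    have := key (1 - Int.fract α) (1 - Int.fract β) (by linarith) (by linarith) (by linarith)
      (by linarith) (by linarith) (by
        have := lattice_sub (lattice_add hu hv) hf
        convert this using 1
        module)
    linarith [this.1]

/-- The interior point of the triangle is its centroid. -/
lemma interior_eq_centroid {P : Set (Fin 3 → ℝ)} {p : Fin 5 → (Fin 3 → ℝ)} (h : IsOrdering P p)
    (hP : P = convexHull ℝ (range p)) {a b c : ℝ} (ha : 0 < a) (hb : 0 < b) (hc : 0 < c)
    (he : a • (p 1 - p 0) + b • (p 2 - p 0) + c • (p 3 - p 0) = 0)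
    (hd : det3 (p 1 - p 0) (p 2 - p 0) (p 4 - p 0) ≠ 0) :
    p 3 - p 0 = -(p 1 - p 0) - (p 2 - p 0) := by
  have hlat : ∀ i, p i - p 0 ∈ lattice 3 := fun i =>
    lattice_sub (h.mem_lattice i) (h.mem_lattice 0)
  have hs := eq_combination_of_pos hc he
  -- the ratios of the coefficients are integers, for each of the three cyclic orderings
  have rot : ∀ (σ : Fin 5 → Fin 5), Function.Injective σ → ∀ a b c : ℝ, 0 < a → 0 < b → 0 < c →
      σ 0 = 0 → a • (p (σ 1) - p 0) + b • (p (σ 2) - p 0) + c • (p (σ 3) - p 0) = 0 →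
      det3 (p (σ 1) - p 0) (p (σ 2) - p 0) (p (σ 4) - p 0) ≠ 0 →
      ∃ m n : ℤ, -(a / c) = m ∧ -(b / c) = n := by
    intro σ hσ a b c ha hb hc h0 he hd
    have hr : range (p ∘ σ) = range p := (Finite.surjective_of_injective hσ).range_comp p
    refine int_of_mem_lattice (h.comp hσ) (by rw [hr]; exact hP) ha hb hc
      (by simpa [h0] using he) (by simpa [h0] using hd) _ _ ?_
    simp only [Function.comp, h0]
    rw [← eq_combination_of_pos hc he]
    exact hlat _
  obtain ⟨m, n, hm, hn⟩ := rot id Function.injective_id a b c ha hb hc rfl he hd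
  have hd1 : det3 (p 2 - p 0) (p 3 - p 0) (p 4 - p 0) ≠ 0 := by
    have : det3 (p 2 - p 0) (p 3 - p 0) (p 4 - p 0) =
        a / c * det3 (p 1 - p 0) (p 2 - p 0) (p 4 - p 0) := by
      rw [hs]
      simp only [det3, Pi.add_apply, Pi.smul_apply, smul_eq_mul]
      ring
    rw [this]
    exact mul_ne_zero (div_pos ha hc).ne' hd
  have hd2 : det3 (p 3 - p 0) (p 1 - p 0) (p 4 - p 0) ≠ 0 := by
    have : det3 (p 3 - p 0) (p 1 - p 0) (p 4 - p 0) =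
        b / c * det3 (p 1 - p 0) (p 2 - p 0) (p 4 - p 0) := by
      rw [hs]
      simp only [det3, Pi.add_apply, Pi.smul_apply, smul_eq_mul]
      ring
    rw [this]
    exact mul_ne_zero (div_pos hb hc).ne' hd
  obtain ⟨-, k, -, hk⟩ := rot ![0, 2, 3, 1, 4] (by decide) b c a hb hc ha rfl
    (by simp; rw [← he]; abel) (by simpa using hd1)
  obtain ⟨l, -, hl, -⟩ := rot ![0, 3, 1, 2, 4] (by decide) c a b hc ha hb rfl
    (by simp; rw [← he]; abel) (by simpa using hd2)
  -- The rotated orderings supply the inverse ratios `c / a` and `c / b`, and a negative integer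
  -- with integer inverse is -1.
  have neg_one : ∀ x y : ℝ, 0 < x → 0 < y → ∀ m k : ℤ, -(x / y) = m → -(y / x) = k →
      -(x / y) = -1 := by
    intro x y hx hy m k hm hk
    have hmul : (m : ℝ) * k = 1 := by
      rw [← hm, ← hk]; field_simp
    have hmul' : m * k = 1 := by exact_mod_cast hmul
    have hneg : (m : ℝ) < 0 := by rw [← hm]; linarith [div_pos hx hy]
    rcases Int.isUnit_iff.1 (IsUnit.of_mul_eq_one k hmul') with h | h
    · rw [h] at hneg; norm_num at hneg
    · rw [hm, h]; norm_num
  rw [hs, neg_one a c ha hc m k hm hk, neg_one b c hb hc n l hn hl]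
  module

/-! ### The apex -/

/-- The lattice points in the slice at height one force the position of the apex. -/
lemma apex_arith {q a b : ℤ} (hq : 2 ≤ q) (ha : 0 ≤ a) (haq : a < q) (hb : 0 ≤ b) (hbq : b < q)
    (H : ∀ i j : ℤ, q * (i + j) ≤ a + b + q - 1 →
      q * (j - 2 * i) ≤ b - 2 * a + q - 1 → q * (i - 2 * j) ≤ a - 2 * b + q - 1 → False) :
    (a = 2 * b ∧ q = 3 * b) ∨ (b = 2 * a ∧ q = 3 * a) := by
  have h00 := H 0 0
  have h10 := H 1 0
  have h01 := H 0 1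
  have h11 := H 1 1
  norm_num at h00 h10 h01 h11
  by_contra hcon
  -- If `(1, 0)` and `(1, 1)` both fail here, then `a ≤ 2b` and `a + b ≤ q ≤ 2a - b`, so equality
  -- holds throughout. The case `c1'` is the mirror image, and otherwise `(0, 0)` is a point of the
  -- slice.
  by_cases c1 : q ≤ 2 * a - b
  · have c2 : ¬ (1 ≤ a - 2 * b) := fun c => by
      have := h10 (by linarith) (by linarith); linarith
    have c3 : ¬ (q + 1 ≤ a + b) := fun c => by
      have := h11 (by linarith) (by linarith); linarith
    omega
  · by_cases c1' : q ≤ 2 * b - a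
    · have c2 : ¬ (1 ≤ b - 2 * a) := fun c => by
        have := h01 (by linarith) (by linarith); linarith
      have c3 : ¬ (q + 1 ≤ a + b) := fun c => by
        have := h11 (by linarith) (by linarith); linarith
      omega
    · have := h00 (by linarith) (by linarith)
      linarith

/-- Every polytope of size `5` and signature `(3,1)` has one of two normal forms, in suitable
generators `u`, `v`, `r` of the lattice. -/
lemma exists_normal_form {P : Set (Fin 3 → ℝ)} (hP : IsLatticeDPolytope P)
    (hsig : HasSignature P 3 1) :
    ∃ (p : Fin 5 → (Fin 3 → ℝ)) (r : Fin 3 → ℝ), IsOrdering P p ∧ r ∈ lattice 3 ∧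
      Generates (p 1 - p 0) (p 2 - p 0) r ∧
      p 3 - p 0 = -(p 1 - p 0) - (p 2 - p 0) ∧
      (p 4 - p 0 = r ∨
        p 4 - p 0 = (2 : ℝ) • (p 1 - p 0) + (p 2 - p 0) + (3 : ℝ) • r) := by
  obtain ⟨p, h, a₀, b₀, c₀, ha₀, hb₀, hc₀, he⟩ := exists_ordering_of_signature hsig
  have hPp := h.eq_convexHull hP.1
  have hd := det3_ne_zero hPp hP.2 hc₀.ne' he
  have hcen := interior_eq_centroid h hPp ha₀ hb₀ hc₀ he hd
  have hlat : ∀ i, p i - p 0 ∈ lattice 3 := fun i =>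
    lattice_sub (h.mem_lattice i) (h.mem_lattice 0)
  obtain ⟨r₁, hr₁, hgen₁⟩ := exists_generates (hlat 1) (hlat 2) (hlat 4) hd
    (int_of_mem_lattice h hPp ha₀ hb₀ hc₀ he hd)
  set u := p 1 - p 0 with hu
  set v := p 2 - p 0 with hv
  set w := p 4 - p 0 with hw
  obtain ⟨r₀, q, a₁, b₁, hr₀, hgen₀, hq, hw₀⟩ : ∃ (r₀ : Fin 3 → ℝ) (q a₁ b₁ : ℤ),
      r₀ ∈ lattice 3 ∧ Generates u v r₀ ∧ 0 < q ∧
      w = (a₁ : ℝ) • u + (b₁ : ℝ) • v + (q : ℝ) • r₀ := by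
    obtain ⟨a, b, q, e⟩ := hgen₁ w (hlat 4)
    rcases lt_trichotomy q 0 with hq | hq | hq
    · refine ⟨-r₁, -q, a, b, by simpa using lattice_smul hr₁ (-1), fun x hx => ?_, by omega, ?_⟩
      · obtain ⟨i, j, k, e⟩ := hgen₁ x hx
        exact ⟨i, j, -k, by rw [e]; push_cast; module⟩
      · rw [e]; push_cast; module
    · exfalso
      apply hd
      rw [e, det3_right_combination, hq]
      simp
    · exact ⟨r₁, q, a, b, hr₁, hgen₁, hq, e⟩
  -- Adding integer multiples of `u` and `v` to `r` reduces both coefficients modulo `q`.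
  obtain ⟨r, a, b, hr, hgen, ha, haq, hb, hbq, hwr⟩ : ∃ (r : Fin 3 → ℝ) (a b : ℤ),
      r ∈ lattice 3 ∧ Generates u v r ∧ 0 ≤ a ∧ a < q ∧ 0 ≤ b ∧ b < q ∧
      w = (a : ℝ) • u + (b : ℝ) • v + (q : ℝ) • r := by
    refine ⟨r₀ + ((a₁ / q : ℤ) : ℝ) • u + ((b₁ / q : ℤ) : ℝ) • v, a₁ % q, b₁ % q,
      lattice_add (lattice_add hr₀ (lattice_smul (hlat 1) _)) (lattice_smul (hlat 2) _),
      fun x hx => ?_, Int.emod_nonneg _ hq.ne', Int.emod_lt_of_pos _ hq,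
      Int.emod_nonneg _ hq.ne', Int.emod_lt_of_pos _ hq, ?_⟩
    · obtain ⟨i, j, k, e⟩ := hgen₀ x hx
      exact ⟨i - k * (a₁ / q), j - k * (b₁ / q), k, by rw [e]; push_cast; module⟩
    · have e1 : (a₁ : ℝ) = ((a₁ % q : ℤ) : ℝ) + q * ((a₁ / q : ℤ) : ℝ) := by
        exact_mod_cast (Int.emod_add_mul_ediv a₁ q).symm
      have e2 : (b₁ : ℝ) = ((b₁ % q : ℤ) : ℝ) + q * ((b₁ / q : ℤ) : ℝ) := by
        exact_mod_cast (Int.emod_add_mul_ediv b₁ q).symm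
      rw [hw₀, e1, e2]
      module
  have hqR : (0 : ℝ) < q := by exact_mod_cast hq
  -- no lattice point of `P` lies strictly between the triangle and the apex
  have empty : ∀ α β γ : ℝ, 0 < γ → γ < 1 → α + β ≤ 1 - γ → β - 2 * α ≤ 1 - γ →
      α - 2 * β ≤ 1 - γ → α • u + β • v + γ • w ∈ lattice 3 → False := by
    intro α β γ hγ0 hγ1 h1 h2 h3 hmem
    -- Barycentric coordinates with respect to the tetrahedron `p 1, p 2, p 3, p 4`; the weight of
    -- `p 0` is zero.
    have hx := combination_mem hPp (a := (1 - γ + 2 * α - β) / 3) (b := (1 - γ + 2 * β - α) / 3)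
      (c := (1 - γ - α - β) / 3) (d := γ) (by linarith) (by linarith) (by linarith) hγ0.le
      (by linarith)
    rw [← hu, ← hv, ← hw, hcen] at hx
    have e : p 0 + ((1 - γ + 2 * α - β) / 3) • u + ((1 - γ + 2 * β - α) / 3) • v +
        ((1 - γ - α - β) / 3) • (-u - v) + γ • w = p 0 + (α • u + β • v + γ • w) := by
      module
    rw [e] at hx
    obtain ⟨i, hi⟩ : p 0 + (α • u + β • v + γ • w) ∈ range p :=
      h.2 ▸ ⟨hx, lattice_add (h.mem_lattice 0) hmem⟩
    have hcase : ∀ s t r : ℝ, p i - p 0 = s • u + t • v + r • w → γ = r := fun s t r e =>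
      (combination_unique hd (a := α) (b := β) (by rw [← e, hi]; abel)).2.2
    fin_cases i
    · have := hcase 0 0 0 (by simp)
      linarith
    · have := hcase 1 0 0 (by simp [hu])
      linarith
    · have := hcase 0 1 0 (by simp [hv])
      linarith
    · have := hcase (-1) (-1) 0 (by change p 3 - p 0 = _; rw [hcen]; module)
      linarith
    · have := hcase 0 0 1 (by simp [hw])
      linarith
  -- For `b ≥ 2` the vector `w / b` would be a lattice vector, giving a lattice point of `P` between
  -- `p 0` and the apex.
  have final : ∀ b : ℤ, q = 3 * b → ∀ i j : ℤ,
      w = ((i * b : ℤ) : ℝ) • u + ((j * b : ℤ) : ℝ) • v + (q : ℝ) • r → b = 1 := by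
    intro b hqb i j hw'
    by_contra hb1
    have hb2 : 2 ≤ b := by omega
    have hb2R : (2 : ℝ) ≤ b := by exact_mod_cast hb2
    have hbinv : (b : ℝ)⁻¹ < 1 := inv_lt_one_of_one_lt₀ (by linarith)
    refine empty 0 0 (b : ℝ)⁻¹ (by positivity) hbinv (by linarith) (by linarith) (by linarith) ?_
    have : (0 : ℝ) • u + (0 : ℝ) • v + (b : ℝ)⁻¹ • w =
        (i : ℝ) • u + (j : ℝ) • v + ((3 : ℤ) : ℝ) • r := by
      have hb0 : (b : ℝ) ≠ 0 := by linarith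
      rw [hw', hqb]
      simp only [zero_smul, zero_add, smul_add, smul_smul]
      push_cast
      congr 2
      · congr 1; field_simp
      · congr 1; field_simp
      · field_simp
    rw [this]
    exact lattice_add (lattice_add (lattice_smul (hlat 1) _) (lattice_smul (hlat 2) _))
      (lattice_smul hr _)
  rcases lt_or_ge q 2 with hq2 | hq2
  · refine ⟨p, r, h, hr, hgen, hcen, Or.inl ?_⟩
    obtain rfl : q = 1 := by omega
    obtain rfl : a = 0 := by omega
    obtain rfl : b = 0 := by omega
    rw [← hw, hwr]
    simp
  · have harith := apex_arith hq2 ha haq hb hbq (fun i j h1 h2 h3 => by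
      have h1' : (q : ℝ) * (i + j) ≤ a + b + q - 1 := by exact_mod_cast h1
      have h2' : (q : ℝ) * (j - 2 * i) ≤ b - 2 * a + q - 1 := by exact_mod_cast h2
      have h3' : (q : ℝ) * (i - 2 * j) ≤ a - 2 * b + q - 1 := by exact_mod_cast h3
      have hq2' : (2 : ℝ) ≤ q := by exact_mod_cast hq2
      have scale : ∀ x : ℝ, q * x ≤ q * (1 - (q : ℝ)⁻¹) → x ≤ 1 - (q : ℝ)⁻¹ := fun x hx =>
        le_of_mul_le_mul_left hx hqR
      have hqi : (q : ℝ) * (q : ℝ)⁻¹ = 1 := mul_inv_cancel₀ hqR.ne'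
      -- These are the coordinates of `i u + j v + r` in terms of `u`, `v`, `w`; the `q - 1` in the
      -- hypotheses is `q (1 - 1/q)`.
      refine empty (i - a * (q : ℝ)⁻¹) (j - b * (q : ℝ)⁻¹) (q : ℝ)⁻¹ (by positivity)
        (inv_lt_one_of_one_lt₀ (by linarith)) (scale _ ?_) (scale _ ?_) (scale _ ?_) ?_
      · linear_combination h1' - (a + b - 1) * hqi
      · linear_combination h2' - (b - 2 * a - 1) * hqi
      · linear_combination h3' - (a - 2 * b - 1) * hqi
      · have e : ((i : ℝ) - a * (q : ℝ)⁻¹) • u + ((j : ℝ) - b * (q : ℝ)⁻¹) • v + (q : ℝ)⁻¹ • w =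
            (i : ℝ) • u + (j : ℝ) • v + r := by
          have er : (q : ℝ)⁻¹ • ((q : ℝ) • r) = r := by
            rw [smul_smul, inv_mul_cancel₀ hqR.ne', one_smul]
          rw [hwr, smul_add, er]
          module
        rw [e]
        exact lattice_add (lattice_add (lattice_smul (hlat 1) _) (lattice_smul (hlat 2) _)) hr)
    rcases harith with ⟨h1, h2⟩ | ⟨h1, h2⟩
    · have hb1 := final b h2 2 1 (by rw [hwr, h1]; simp)
      refine ⟨p, r, h, hr, hgen, hcen, Or.inr ?_⟩
      rw [← hu, ← hv, ← hw, hwr, h1, h2, hb1]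
      norm_num
    · have ha1 := final a h2 1 2 (by rw [hwr, h1]; simp)
      refine ⟨p ∘ ![0, 2, 1, 3, 4], r, h.comp (by decide), hr, fun x hx => ?_, ?_, Or.inr ?_⟩
      · obtain ⟨i, j, k, e⟩ := hgen x hx
        refine ⟨j, i, k, ?_⟩
        simp only [Function.comp, Matrix.cons_val]
        rw [← hu, ← hv, e]
        abel
      · simp only [Function.comp, Matrix.cons_val]
        rw [hcen, ← hu, ← hv]
        abel
      · simp only [Function.comp, Matrix.cons_val]
        rw [← hu, ← hv, ← hw, hwr, h1, h2, ha1]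
        norm_num
        abel

/-! ### Volume vectors and equivalence -/

lemma volumeVector_eq {p : Fin 5 → (Fin 3 → ℝ)}
    (h : p 3 - p 0 = -(p 1 - p 0) - (p 2 - p 0)) :
    volumeVector p = ![3 * det3 (p 1 - p 0) (p 2 - p 0) (p 4 - p 0),
      -det3 (p 1 - p 0) (p 2 - p 0) (p 4 - p 0), -det3 (p 1 - p 0) (p 2 - p 0) (p 4 - p 0),
      -det3 (p 1 - p 0) (p 2 - p 0) (p 4 - p 0), 0] := by
  have h3 : p 3 = (3 : ℝ) • p 0 - p 1 - p 2 := by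
    rw [sub_eq_iff_eq_add] at h
    rw [h]
    module
  ext k
  fin_cases k <;>
    simp [volumeVector, signedVolume, Matrix.det_succ_row_zero, Fin.sum_univ_succ,
      Fin.succAbove, Fin.cons, h3, det3, Matrix.submatrix] <;> ring

/-- Exchanging `p 1` and `p 2` negates the determinant, so its sign can be chosen to be that of
`-q`. -/
lemma hasVolumeVector_of_normal_form {P : Set (Fin 3 → ℝ)} {p : Fin 5 → (Fin 3 → ℝ)}
    (h : IsOrdering P p) (hcen : p 3 - p 0 = -(p 1 - p 0) - (p 2 - p 0)) {q : ℝ}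
    (hd : det3 (p 1 - p 0) (p 2 - p 0) (p 4 - p 0) = q ∨
      det3 (p 1 - p 0) (p 2 - p 0) (p 4 - p 0) = -q) :
    HasVolumeVector P ![-3 * q, q, q, q, 0] := by
  rcases hd with hd | hd
  · refine ⟨p ∘ ![0, 2, 1, 3, 4], h.comp (by decide), ?_⟩
    have hs : det3 (p 2 - p 0) (p 1 - p 0) (p 4 - p 0) = -q := by
      rw [← hd]; simp only [det3]; ring
    rw [volumeVector_eq (by simp only [Function.comp, Matrix.cons_val]; rw [hcen]; abel)]
    simp only [Function.comp, Matrix.cons_val]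
    rw [hs]
    simp
  · refine ⟨p, h, ?_⟩
    rw [volumeVector_eq hcen, hd]
    simp

lemma range_fin_five {α : Type*} (p : Fin 5 → α) : range p = {p 0, p 1, p 2, p 3, p 4} := by
  ext x
  simp only [mem_range, Fin.exists_fin_succ, mem_insert_iff, mem_singleton_iff]
  simp [eq_comm]

/-- The equivalence is the inverse of the coordinate map. The vector `r` goes with the middle
coordinate because the configurations have their triangle in the plane where that coordinate
vanishes. -/
lemma zEquivalent_of_generates {P : Set (Fin 3 → ℝ)} {p : Fin 5 → (Fin 3 → ℝ)}
    (hP : P = convexHull ℝ (range p)) {x u v r : Fin 3 → ℝ} (hx : x ∈ lattice 3)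
    (hu : u ∈ lattice 3) (hv : v ∈ lattice 3) (hr : r ∈ lattice 3) (hgen : Generates u v r)
    {s : Fin 5 → (Fin 3 → ℝ)} (hs : ∀ i, p i = x + (s i 0 • u + s i 1 • r + s i 2 • v)) :
    ZEquivalent P (convexHull ℝ {s 0, s 1, s 2, s 3, s 4}) := by
  rw [← range_fin_five]
  have hd : det3 u v r ≠ 0 := by
    rcases hgen.det3_eq hu hv hr with h | h <;> rw [h] <;> norm_num
  let L : (Fin 3 → ℝ) →ₗ[ℝ] (Fin 3 → ℝ) := Fintype.linearCombination ℝ ![u, r, v]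
  have hL : ∀ y, L y = y 0 • u + y 1 • r + y 2 • v := fun y => by
    simp [L, Fintype.linearCombination_apply, Fin.sum_univ_succ, add_assoc]
  have hinj : Function.Injective L := by
    intro y z hyz
    rw [hL, hL, add_right_comm, add_right_comm (z 0 • u)] at hyz
    obtain ⟨h0, h2, h1⟩ := combination_unique hd hyz
    ext i
    fin_cases i
    exacts [h0, h1, h2]
  let t : (Fin 3 → ℝ) ≃ᵃ[ℝ] (Fin 3 → ℝ) :=
    (LinearEquiv.ofInjectiveEndo L hinj).toAffineEquiv.trans (AffineEquiv.constVAdd ℝ _ x)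
  have ht : ∀ y, t y = x + (y 0 • u + y 1 • r + y 2 • v) := fun y => by
    rw [← hL]; rfl
  have himg : ∀ A B : Set (Fin 3 → ℝ), t '' A = B → t.symm '' B = A := by
    rintro A _ rfl
    rw [image_image]
    simp
  refine ⟨t.symm, himg _ _ ?_, himg _ _ ?_⟩
  · apply Subset.antisymm
    · rintro _ ⟨y, hy, rfl⟩
      rw [ht]
      obtain ⟨a, ha⟩ := hy 0
      obtain ⟨b, hb⟩ := hy 1
      obtain ⟨c, hc⟩ := hy 2
      rw [ha, hb, hc]
      exact lattice_add hx (lattice_add (lattice_add (lattice_smul hu _) (lattice_smul hr _))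
        (lattice_smul hv _))
    · intro z hz
      obtain ⟨a, b, c, e⟩ := hgen (z - x) (lattice_sub hz hx)
      refine ⟨_, vec3_mem_lattice a c b, ?_⟩
      rw [ht]
      simp only [Matrix.cons_val]
      rw [add_right_comm, ← e]
      abel
  · have := t.toAffineMap.image_convexHull (range s)
    simp only [AffineEquiv.coe_toAffineMap] at this
    rw [this, ← range_comp, hP]
    congr 2
    funext i
    rw [Function.comp, ht, hs]

theorem classification {P : Set (Fin 3 → ℝ)} (hP : IsLatticeDPolytope P)
    (hsig : HasSignature P 3 1) :
    (∃ q : ℝ, (q = 1 ∨ q = 3) ∧ HasVolumeVector P ![-3 * q, q, q, q, 0]) ∧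
      (ZEquivalent P config₁ ∨ ZEquivalent P config₂) := by
  obtain ⟨p, r, h, hr, hgen, hcen, hw⟩ := exists_normal_form hP hsig
  have hPp := h.eq_convexHull hP.1
  have hlat : ∀ i, p i - p 0 ∈ lattice 3 := fun i =>
    lattice_sub (h.mem_lattice i) (h.mem_lattice 0)
  have hdet := hgen.det3_eq (hlat 1) (hlat 2) hr
  have h3 : p 3 = p 0 + (-(p 1 - p 0) - (p 2 - p 0)) := by rw [← hcen]; abel
  rcases hw with hw | hw
  · refine ⟨⟨1, Or.inl rfl, hasVolumeVector_of_normal_form h hcen (by rw [hw]; exact hdet)⟩,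
      Or.inl (zEquivalent_of_generates hPp (h.mem_lattice 0) (hlat 1) (hlat 2) hr hgen
        (s := ![![0, 0, 0], ![1, 0, 0], ![0, 0, 1], ![-1, 0, -1], ![0, 1, 0]]) ?_)⟩
    have h4 : p 4 = p 0 + r := by rw [← hw]; abel
    intro i
    fin_cases i <;> simp [h3, h4]
    all_goals module
  · refine ⟨⟨3, Or.inr rfl, hasVolumeVector_of_normal_form h hcen ?_⟩,
      Or.inr (zEquivalent_of_generates hPp (h.mem_lattice 0) (hlat 1) (hlat 2) hr hgen
        (s := ![![0, 0, 0], ![1, 0, 0], ![0, 0, 1], ![-1, 0, -1], ![2, 3, 1]]) ?_)⟩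
    · have e := det3_right_combination (p 1 - p 0) (p 2 - p 0) r 2 1 3
      rw [one_smul] at e
      rw [hw, e]
      rcases hdet with h | h <;> rw [h] <;> norm_num
    · have h4 : p 4 = p 0 + ((2 : ℝ) • (p 1 - p 0) + (p 2 - p 0) + (3 : ℝ) • r) := by
        rw [← hw]; abel
      intro i
      fin_cases i <;> simp [h3, h4]
      all_goals module

/-! ### Widths -/

/-- The values of an integer functional. -/
lemma IsIntegerFunctional.exists_coeffs {f : (Fin 3 → ℝ) →ᵃ[ℝ] ℝ} (hf : IsIntegerFunctional f) :
    ∃ a b c d : ℤ, (a ≠ 0 ∨ b ≠ 0 ∨ c ≠ 0) ∧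
      ∀ x : Fin 3 → ℝ, f x = a * x 0 + b * x 1 + c * x 2 + d := by
  obtain ⟨hint, x, y, hxy⟩ := hf
  have hlin : ∀ x : Fin 3 → ℝ, f x = (f ![1, 0, 0] - f ![0, 0, 0]) * x 0 +
      (f ![0, 1, 0] - f ![0, 0, 0]) * x 1 + (f ![0, 0, 1] - f ![0, 0, 0]) * x 2 +
      f ![0, 0, 0] := by
    have hz : (![0, 0, 0] : Fin 3 → ℝ) = 0 := by ext i; fin_cases i <;> rfl
    have hd : ∀ z, f z - f 0 = f.linear z := fun z => by
      have := f.linearMap_vsub z 0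
      simpa using this.symm
    intro x
    have hx : x = x 0 • ![1, 0, 0] + x 1 • ![0, 1, 0] + x 2 • ![0, 0, 1] := by
      ext i; fin_cases i <;> simp
    rw [hz, hd, hd, hd, ← sub_eq_iff_eq_add, hd]
    conv_lhs => rw [hx]
    simp only [map_add, map_smul, smul_eq_mul]
    ring
  obtain ⟨d, hd⟩ := hint ![0, 0, 0] (by simpa using vec3_mem_lattice 0 0 0)
  obtain ⟨a, ha⟩ := hint ![1, 0, 0] (by simpa using vec3_mem_lattice 1 0 0)
  obtain ⟨b, hb⟩ := hint ![0, 1, 0] (by simpa using vec3_mem_lattice 0 1 0)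
  obtain ⟨c, hc⟩ := hint ![0, 0, 1] (by simpa using vec3_mem_lattice 0 0 1)
  rw [hd, ha, hb, hc] at hlin
  refine ⟨a - d, b - d, c - d, d, ?_, fun x => by rw [hlin x]; push_cast; ring⟩
  by_contra! hall
  apply hxy
  obtain ⟨h1, h2, h3⟩ := hall
  rw [sub_eq_zero] at h1 h2 h3
  rw [hlin x, hlin y, h1, h2, h3]
  ring

lemma HasWidthWrt.sub_le {d : ℕ} {P : Set (Fin d → ℝ)} {f : (Fin d → ℝ) →ᵃ[ℝ] ℝ} {w : ℝ}
    (h : HasWidthWrt P f w) {x y : Fin d → ℝ} (hx : x ∈ P) (hy : y ∈ P) : f x - f y ≤ w := by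
  obtain ⟨a, b, ha, hb, rfl⟩ := h
  have h1 := hb.2 (mem_image_of_mem f hx)
  have h2 := ha.2 (mem_image_of_mem f hy)
  linarith

lemma hasWidthWrt_convexHull {d : ℕ} {S : Set (Fin d → ℝ)} {f : (Fin d → ℝ) →ᵃ[ℝ] ℝ}
    {x y : Fin d → ℝ} (hx : x ∈ S) (hy : y ∈ S) (hS : ∀ z ∈ S, f x ≤ f z ∧ f z ≤ f y) :
    HasWidthWrt (convexHull ℝ S) f (f y - f x) := by
  have hsub : f '' convexHull ℝ S ⊆ Icc (f x) (f y) := by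
    rw [f.image_convexHull]
    apply convexHull_min _ (convex_Icc _ _)
    rintro _ ⟨z, hz, rfl⟩
    exact hS z hz
  exact ⟨f x, f y, ⟨mem_image_of_mem f (subset_convexHull ℝ S hx), fun _ h => (hsub h).1⟩,
    ⟨mem_image_of_mem f (subset_convexHull ℝ S hy), fun _ h => (hsub h).2⟩, rfl⟩

/-- Three integers with sum zero that differ pairwise by at most 1 all vanish. Here `a`, `c`, `-a -
c` are the values, up to a constant, of a functional at the vertices of the triangle in `config₂`.
-/
lemma two_le_of_sum_zero {a c : ℤ} (h : a ≠ 0 ∨ c ≠ 0) {w : ℝ}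
    (h1 : (a : ℝ) - c ≤ w) (h2 : (c : ℝ) - a ≤ w) (h3 : (a : ℝ) - (-a - c) ≤ w)
    (h4 : (-a - c : ℝ) - a ≤ w) (h5 : (c : ℝ) - (-a - c) ≤ w) (h6 : (-a - c : ℝ) - c ≤ w) :
    2 ≤ w := by
  have cast : ∀ n : ℤ, 2 ≤ n → (n : ℝ) ≤ w → 2 ≤ w := fun n hn h =>
    le_trans (by exact_mod_cast hn) h
  have : 2 ≤ a - c ∨ 2 ≤ c - a ∨ 2 ≤ a - (-a - c) ∨ 2 ≤ (-a - c) - a ∨ 2 ≤ c - (-a - c) ∨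
    2 ≤ (-a - c) - c := by omega
  rcases this with h | h | h | h | h | h <;> exact cast _ h (by push_cast; assumption)

lemma hasWidth_config₁ : HasWidth config₁ 1 := by
  constructor
  · refine ⟨(LinearMap.proj 1 : (Fin 3 → ℝ) →ₗ[ℝ] ℝ).toAffineMap,
      ⟨fun x hx => hx 1, 0, ![0, 1, 0], by simp⟩, ?_⟩
    have h := hasWidthWrt_convexHull (S := {![0, 0, 0], ![1, 0, 0], ![0, 0, 1], ![-1, 0, -1], ![0, 1, 0]})
      (f := (LinearMap.proj 1 : (Fin 3 → ℝ) →ₗ[ℝ] ℝ).toAffineMap)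
      (x := ![0, 0, 0]) (y := ![0, 1, 0]) (by simp) (by simp) (by norm_num)
    norm_num at h
    exact h
  · rintro w ⟨f, hf, hw⟩
    obtain ⟨a, b, c, d, hne, hfx⟩ := hf.exists_coeffs
    have m0 : (![0, 0, 0] : Fin 3 → ℝ) ∈ config₁ := subset_convexHull ℝ _ (by simp)
    have m1 : (![1, 0, 0] : Fin 3 → ℝ) ∈ config₁ := subset_convexHull ℝ _ (by simp)
    have m2 : (![0, 0, 1] : Fin 3 → ℝ) ∈ config₁ := subset_convexHull ℝ _ (by simp)
    have m4 : (![0, 1, 0] : Fin 3 → ℝ) ∈ config₁ := subset_convexHull ℝ _ (by simp)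
    have key : ∀ n : ℤ, n ≠ 0 → (n : ℝ) ≤ w → -(n : ℝ) ≤ w → 1 ≤ w := by
      intro n hn h1 h2
      have h3 : (1 : ℝ) ≤ |(n : ℝ)| := by exact_mod_cast Int.one_le_abs hn
      exact h3.trans (abs_le'.2 ⟨h1, h2⟩)
    rcases hne with h | h | h
    · have h1 := hw.sub_le m1 m0
      have h2 := hw.sub_le m0 m1
      simp [hfx] at h1 h2
      exact key a h (by linarith) (by linarith)
    · have h1 := hw.sub_le m4 m0
      have h2 := hw.sub_le m0 m4
      simp [hfx] at h1 h2
      exact key b h (by linarith) (by linarith)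
    · have h1 := hw.sub_le m2 m0
      have h2 := hw.sub_le m0 m2
      simp [hfx] at h1 h2
      exact key c h (by linarith) (by linarith)

lemma hasWidth_config₂ : HasWidth config₂ 2 := by
  constructor
  -- The functional `x 0 - x 1` takes the values 0, 1, 0, -1, -1 at the five points.
  · refine ⟨((LinearMap.proj 0 : (Fin 3 → ℝ) →ₗ[ℝ] ℝ) - LinearMap.proj 1).toAffineMap,
      ⟨fun x hx => ?_, 0, ![1, 0, 0], fun h => ?_⟩, ?_⟩
    · obtain ⟨m, hm⟩ := hx 0
      obtain ⟨n, hn⟩ := hx 1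
      exact ⟨m - n, by simp [hm, hn]⟩
    · change (0 : ℝ) - 0 = 1 - 0 at h
      norm_num at h
    have h := hasWidthWrt_convexHull (S := {![0, 0, 0], ![1, 0, 0], ![0, 0, 1], ![-1, 0, -1], ![2, 3, 1]})
      (f := ((LinearMap.proj 0 : (Fin 3 → ℝ) →ₗ[ℝ] ℝ) - LinearMap.proj 1).toAffineMap)
      (x := ![-1, 0, -1]) (y := ![1, 0, 0]) (by simp) (by simp) (by norm_num)
    norm_num at h
    exact h
  · rintro w ⟨f, hf, hw⟩
    obtain ⟨a, b, c, d, hne, hfx⟩ := hf.exists_coeffs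
    have m0 : (![0, 0, 0] : Fin 3 → ℝ) ∈ config₂ := subset_convexHull ℝ _ (by simp)
    have m1 : (![1, 0, 0] : Fin 3 → ℝ) ∈ config₂ := subset_convexHull ℝ _ (by simp)
    have m2 : (![0, 0, 1] : Fin 3 → ℝ) ∈ config₂ := subset_convexHull ℝ _ (by simp)
    have m3 : (![-1, 0, -1] : Fin 3 → ℝ) ∈ config₂ := subset_convexHull ℝ _ (by simp)
    have m4 : (![2, 3, 1] : Fin 3 → ℝ) ∈ config₂ := subset_convexHull ℝ _ (by simp)
    by_cases hac : a ≠ 0 ∨ c ≠ 0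
    · have h1 := hw.sub_le m1 m2
      have h2 := hw.sub_le m2 m1
      have h3 := hw.sub_le m1 m3
      have h4 := hw.sub_le m3 m1
      have h5 := hw.sub_le m2 m3
      have h6 := hw.sub_le m3 m2
      simp [hfx] at h1 h2 h3 h4 h5 h6
      apply two_le_of_sum_zero hac <;> linarith
    -- The functional is constant on the triangle, and the apex at height 3 gives width at least 3.
    · push Not at hac
      obtain ⟨rfl, rfl⟩ := hac
      have hb : b ≠ 0 := by simpa using hne
      have h1 := hw.sub_le m4 m0
      have h2 := hw.sub_le m0 m4
      simp [hfx] at h1 h2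
      have h3 : (1 : ℝ) ≤ |(b : ℝ)| := by exact_mod_cast Int.one_le_abs hb
      have h4 : |(b : ℝ)| ≤ w / 3 := abs_le'.2 ⟨by linarith, by linarith⟩
      linarith

end LatticePolytope

theorem mainTheorem8 :
    (∀ P : Set (Fin 3 → ℝ),
      LatticePolytope.IsLatticeDPolytope P →
      LatticePolytope.size P = 5 →
      LatticePolytope.HasSignature P 3 1 →
        (∃ q : ℝ, (q = 1 ∨ q = 3) ∧
          LatticePolytope.HasVolumeVector P ![-3 * q, q, q, q, 0]) ∧
        (LatticePolytope.ZEquivalent P LatticePolytope.config₁ ∨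
          LatticePolytope.ZEquivalent P LatticePolytope.config₂)) ∧
    LatticePolytope.HasWidth LatticePolytope.config₁ 1 ∧
    LatticePolytope.HasWidth LatticePolytope.config₂ 2 :=
  ⟨fun _ hP _ hsig => LatticePolytope.classification hP hsig,
    LatticePolytope.hasWidth_config₁, LatticePolytope.hasWidth_config₂⟩
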